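/- Let $I=[0,1]$ and let $\mathbb{K}^2$ be the Klein bottle, that is, the quotient space of the square $I\times I$ by the equivalence relation generated by $(0,t)\sim(1,t)$ and $(s,0)\sim(1-s,1)$ for $s,t\in I$. Let $x_0\in\mathbb{K}^2$ be the common image of the four corners, and let $\alpha,\beta$ be the loops at $x_0$ given by $\alpha(t)=[(0,t)]$ and $\beta(s)=[(s,0)]$; the boundary of the square, traversed counterclockwise from $(0,0)$, then reads $\beta\alpha\beta\alpha^{-1}$. Then the loop $\beta\alpha\beta\alpha^{-1}$ is homotopic, relative to its endpoints, to the constant loop $\rho_{x_0}$, and the fundamental group $\pi_1(\mathbb{K}^2,x_0)$ is generated by the classes of $\alpha$ and $\beta$ with this as the single defining relation: there is a group isomorphism $$\langle \alpha,\beta \mid \beta\alpha\beta\alpha^{-1}\rangle \;\cong\; \pi_1(\mathbb{K}^2,x_0)$$ that maps the generators $\alpha$ and $\beta$ to the homotopy classes of the loops $\alpha$ and $\beta$. For every other base point $x\in\mathbb{K}^2$ the group $\pi_1(\mathbb{K}^2,x)$ is also isomorphic to $\langle \alpha,\beta \mid \beta\alpha\beta\alpha^{-1}\rangle$. -/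

import Mathlib

/-!
The boundary of the square reads `β α β α⁻¹`, and it is null-homotopic because the square is
contractible: this is the relation. Conversely, the abstract group acts on the plane, `β` by a
translation and `α` by a glide reflection along an orthogonal axis. The relation lets every element
be written as `β ^ m * α ^ n`, and such an element moves points far away when `m` or `n` is large
and fixes none unless `m = n = 0`; hence the action is free and properly discontinuous. The square
is a fundamental domain whose sides are glued by the action exactly as in the Klein bottle, so the
plane is the universal cover of the Klein bottle and the group is its deck group.
-/

open scoped unitInterval

/-- The identifications of the unit square `I × I` that produce the Klein bottle: the left and the
right side are glued with the same orientation, the bottom and the top side with opposite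
orientations. -/
inductive KleinGlue : I × I → I × I → Prop
  | sides (t : I) : KleinGlue (0, t) (1, t)
  | flip (s : I) : KleinGlue (s, 0) (unitInterval.symm s, 1)

/-- The Klein bottle: the quotient of the unit square by the equivalence relation generated by
`KleinGlue`. -/
def KleinBottle : Type := Quot KleinGlue

namespace KleinBottle

/-- The quotient topology. -/
instance : TopologicalSpace KleinBottle := inferInstanceAs (TopologicalSpace (Quot KleinGlue))

/-- The projection of the square onto the Klein bottle. -/
def proj (p : I × I) : KleinBottle := Quot.mk KleinGlue p

theorem continuous_proj : Continuous proj := continuous_quot_mk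

/-- The base point: the common image of the four corners of the square. -/
def basePoint : KleinBottle := proj (0, 0)

theorem proj_one_zero : proj (1, 0) = basePoint := (Quot.sound (KleinGlue.sides 0)).symm

theorem proj_one_one : proj (1, 1) = basePoint := by
  have h := Quot.sound (KleinGlue.flip 0)
  rw [unitInterval.symm_zero] at h
  exact h.symm

theorem proj_zero_one : proj (0, 1) = basePoint :=
  (Quot.sound (KleinGlue.sides 1)).trans proj_one_one

/-- The loop `α`: the image of the left side (equivalently, of the right side) of the square,
traversed upwards. -/
def loopAlpha : Path basePoint basePoint where
  toFun t := proj (0, t)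
  continuous_toFun := continuous_proj.comp (by fun_prop)
  source' := rfl
  target' := proj_zero_one

/-- The loop `β`: the image of the bottom side of the square traversed from left to right
(equivalently, of the top side traversed from right to left). Thus the boundary of the square,
traversed counterclockwise from the corner `(0, 0)`, reads `β α β α⁻¹`. -/
def loopBeta : Path basePoint basePoint where
  toFun s := proj (s, 0)
  continuous_toFun := continuous_proj.comp (by fun_prop)
  source' := rfl
  target' := proj_one_zero

/-- The class of a loop at the base point in the fundamental group. -/
def loopClass (γ : Path basePoint basePoint) : FundamentalGroup KleinBottle basePoint :=
  FundamentalGroup.fromPath (Path.Homotopic.Quotient.mk γ)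

end KleinBottle

/-- The two generator symbols of the presentation. -/
inductive KleinGen
  | α
  | β

/-- The word `β α β α⁻¹` in the free group on the two generator symbols. -/
def kleinRelator : FreeGroup KleinGen :=
  FreeGroup.of KleinGen.β * FreeGroup.of KleinGen.α * FreeGroup.of KleinGen.β *
    (FreeGroup.of KleinGen.α)⁻¹

/-- The group `⟨α, β | β α β α⁻¹⟩`. -/
abbrev KleinGroup : Type := PresentedGroup ({kleinRelator} : Set (FreeGroup KleinGen))

open unitInterval (fract_mem)

instance : ContractibleSpace I := (convex_Icc (0 : ℝ) 1).contractibleSpace ⟨0, by simp⟩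

theorem mem_closure_pair_of_mem_normalizer {G : Type*} [Group G] {a b g : G}
    (ha : a ∈ Subgroup.normalizer (Subgroup.zpowers b : Set G)) :
    g ∈ Subgroup.closure {b, a} ↔ ∃ m n : ℤ, b ^ m * a ^ n = g := by
  have hle : Subgroup.zpowers a ≤ Subgroup.normalizer (Subgroup.zpowers b : Set G) :=
    Subgroup.zpowers_le.mpr ha
  rw [Set.insert_eq, Subgroup.closure_union, ← Subgroup.zpowers_eq_closure,
    ← Subgroup.zpowers_eq_closure, ← SetLike.mem_coe,
    Subgroup.coe_mul_of_right_le_normalizer_left _ _ hle, Set.mem_mul]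
  simp only [SetLike.mem_coe, Subgroup.exists_mem_zpowers]

theorem mem_normalizer_zpowers_of_conj_eq_inv {G : Type*} [Group G] {a b : G}
    (h : a * b * a⁻¹ = b⁻¹) : a ∈ Subgroup.normalizer (Subgroup.zpowers b : Set G) := by
  rw [Subgroup.mem_normalizer_iff_map_conj_eq, MonoidHom.map_zpowers]
  simp [h]

section Deck

variable {E X G : Type*} [TopologicalSpace E] [TopologicalSpace X] [Group G] [MulAction G E]
  [SimplyConnectedSpace E] {f : E → X} (hf : IsQuotientCoveringMap f G) {x : X} (e : f ⁻¹' {x})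

/-- The isomorphism from the group of a simply connected quotient covering to the fundamental group
of the base. It sends `g` to the class of the loops that lift to a path from `e` to `g⁻¹ • e`; the
inversion is there because `FundamentalGroup` is *anti*-isomorphic to the group of the covering. -/
noncomputable def deckMulEquivFundamentalGroup : G ≃* FundamentalGroup X x :=
  (MulEquiv.inv' G).trans (hf.fundamentalGroupEquiv e).symm

variable {e}

theorem deckMulEquivFundamentalGroup_eq_of_lift {g : G} {γ : Path x x}
    (Γ : Path (e : E) (g⁻¹ • (e : E))) (hΓ : ∀ t, f (Γ t) = γ t) :
    deckMulEquivFundamentalGroup hf e g = FundamentalGroup.fromPath (.mk γ) := by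
  have hmem : g⁻¹ • (e : E) ∈ f ⁻¹' {x} := (hf.map_smul g⁻¹).trans e.2
  have hmonodromy : hf.isCoveringMap.monodromy (.mk γ) e = ⟨g⁻¹ • (e : E), hmem⟩ :=
    hf.isCoveringMap.monodromy_eq_of_map_eq (.mk Γ)
      (congrArg Path.Homotopic.Quotient.mk (Path.ext (funext hΓ)))
  exact (hf.fundamentalGroupEquiv e).symm_apply_eq.mpr <| Eq.symm <|
    hf.fundamentalGroupToMulOpposite_apply_eq_Iff.mpr (congrArg Subtype.val hmonodromy).symm

end Deck

namespace KleinGroup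

/-- The generator `α` of the presented group. -/
abbrev alpha : KleinGroup := PresentedGroup.of KleinGen.α

/-- The generator `β` of the presented group. -/
abbrev beta : KleinGroup := PresentedGroup.of KleinGen.β

theorem alpha_mul_beta_mul_alpha_inv : alpha * beta * alpha⁻¹ = beta⁻¹ := by
  have h : beta * alpha * beta * alpha⁻¹ = 1 :=
    PresentedGroup.one_of_mem (Set.mem_singleton kleinRelator)
  rw [eq_inv_iff_mul_eq_one, mul_eq_one_iff_eq_inv', eq_inv_iff_mul_eq_one]
  simpa only [mul_assoc] using h

theorem closure_beta_alpha : Subgroup.closure {beta, alpha} = ⊤ := by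
  have h : Set.range (PresentedGroup.of : KleinGen → KleinGroup) = {beta, alpha} := by
    ext g
    constructor
    · rintro ⟨_ | _, rfl⟩ <;> simp
    · rintro (rfl | rfl) <;> exact Set.mem_range_self _
  rw [← h, PresentedGroup.closure_range_of]

theorem exists_zpow_mul_zpow_eq (g : KleinGroup) : ∃ m n : ℤ, beta ^ m * alpha ^ n = g :=
  (mem_closure_pair_of_mem_normalizer
    (mem_normalizer_zpowers_of_conj_eq_inv alpha_mul_beta_mul_alpha_inv)).mp
    (closure_beta_alpha ▸ Subgroup.mem_top g)

/-- The action of the presented group on the plane by homeomorphisms: `α` acts as the glide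
reflection `(x, y) ↦ (-x, y - 1)` and `β` as the translation `(x, y) ↦ (x - 1, y)`. With these
signs the lifts of the loops `α` and `β` at the origin end at `α⁻¹ • (0, 0)` and `β⁻¹ • (0, 0)`, as
`deckMulEquivFundamentalGroup` wants. -/
def toHomeomorph : KleinGroup →* (ℝ × ℝ ≃ₜ ℝ × ℝ) :=
  PresentedGroup.toGroup
    (f := fun
      | .α => (Homeomorph.neg ℝ).prodCongr (Homeomorph.subRight 1)
      | .β => (Homeomorph.subRight 1).prodCongr (Homeomorph.refl ℝ)) (by
    rintro _ rfl
    ext p <;> simp [kleinRelator, Homeomorph.subRight])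

instance : MulAction KleinGroup (ℝ × ℝ) where
  smul g p := toHomeomorph g p
  one_smul p := by
    change toHomeomorph 1 p = p
    rw [map_one, Homeomorph.one_apply]
  mul_smul g h p := by
    change toHomeomorph (g * h) p = toHomeomorph g (toHomeomorph h p)
    rw [map_mul, Homeomorph.mul_apply]

instance : ContinuousConstSMul KleinGroup (ℝ × ℝ) where
  continuous_const_smul g := (toHomeomorph g).continuous

theorem alpha_smul (p : ℝ × ℝ) : alpha • p = (-p.1, p.2 - 1) :=
  DFunLike.congr_fun (PresentedGroup.toGroup.of _) p

theorem beta_smul (p : ℝ × ℝ) : beta • p = (p.1 - 1, p.2) :=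
  DFunLike.congr_fun (PresentedGroup.toGroup.of _) p

theorem alpha_zpow_smul (n : ℤ) (p : ℝ × ℝ) : alpha ^ n • p = ((-1) ^ n * p.1, p.2 - n) := by
  induction n with
  | zero => simp
  | succ k ih =>
    rw [add_comm, zpow_one_add, mul_smul, ih, alpha_smul, zpow_one_add₀ (by norm_num)]
    ext <;> push_cast <;> ring
  | pred k ih =>
    rw [sub_eq_neg_add, zpow_add, zpow_neg_one, mul_smul, ih, inv_smul_eq_iff, alpha_smul,
      zpow_add₀ (by norm_num)]
    ext <;> push_cast <;> ring_nf

theorem beta_zpow_smul (m : ℤ) (p : ℝ × ℝ) : beta ^ m • p = (p.1 - m, p.2) := by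
  induction m with
  | zero => simp
  | succ k ih =>
    rw [add_comm, zpow_one_add, mul_smul, ih, beta_smul]
    ext <;> push_cast <;> ring
  | pred k ih =>
    rw [sub_eq_neg_add, zpow_add, zpow_neg_one, mul_smul, ih, inv_smul_eq_iff, beta_smul]
    ext <;> push_cast <;> ring

theorem zpow_mul_zpow_smul (m n : ℤ) (p : ℝ × ℝ) :
    (beta ^ m * alpha ^ n) • p = ((-1) ^ n * p.1 - m, p.2 - n) := by
  rw [mul_smul, alpha_zpow_smul, beta_zpow_smul]

instance : IsCancelSMul KleinGroup (ℝ × ℝ) := by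
  refine isCancelSMul_iff_eq_one_of_smul_eq.mpr fun g p h ↦ ?_
  obtain ⟨m, n, rfl⟩ := exists_zpow_mul_zpow_eq g
  rw [zpow_mul_zpow_smul, Prod.ext_iff] at h
  obtain rfl : n = 0 := by simpa using h.2
  obtain rfl : m = 0 := by simpa using h.1
  simp

theorem norm_exponents_le (m n : ℤ) (p : ℝ × ℝ) :
    ‖(m, n)‖ ≤ ‖p‖ + ‖(beta ^ m * alpha ^ n) • p‖ := by
  rw [zpow_mul_zpow_smul]
  refine norm_prod_le_iff.mpr ⟨?_, ?_⟩
  · calc ‖m‖ = ‖(-1) ^ n * p.1 - ((-1) ^ n * p.1 - m)‖ := by rw [sub_sub_cancel, Int.norm_cast_real]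
      _ ≤ ‖(-1) ^ n * p.1‖ + ‖(-1) ^ n * p.1 - m‖ := norm_sub_le _ _
      _ = ‖p.1‖ + ‖(-1) ^ n * p.1 - m‖ := by simp
      _ ≤ _ := add_le_add (norm_fst_le p) (norm_fst_le (_, _))
  · calc ‖n‖ = ‖p.2 - (p.2 - n)‖ := by rw [sub_sub_cancel, Int.norm_cast_real]
      _ ≤ ‖p.2‖ + ‖p.2 - n‖ := norm_sub_le _ _
      _ ≤ _ := add_le_add (norm_snd_le p) (norm_snd_le (_, _))

instance : ProperlyDiscontinuousSMul KleinGroup (ℝ × ℝ) where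
  finite_disjoint_inter_image {K L} hK hL := by
    obtain ⟨R, hR⟩ := (hK.union hL).isBounded.exists_norm_le
    have hfinite : (Metric.closedBall (0 : ℤ × ℤ) (R + R)).Finite :=
      (isCompact_closedBall _ _).finite_of_discrete
    refine (hfinite.image fun k ↦ beta ^ k.1 * alpha ^ k.2).subset ?_
    rintro g ⟨_, ⟨p, hp, rfl⟩, hgp⟩
    obtain ⟨m, n, rfl⟩ := exists_zpow_mul_zpow_eq g
    refine ⟨(m, n), mem_closedBall_zero_iff.mpr ?_, rfl⟩
    exact (norm_exponents_le m n p).trans (add_le_add (hR p (.inl hp)) (hR _ (.inr hgp)))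

/-- The orbit space of the action on the plane, the model of the Klein bottle that comes with a
universal covering. -/
abbrev OrbitSpace : Type := Quotient (MulAction.orbitRel KleinGroup (ℝ × ℝ))

end KleinGroup

namespace KleinBottle

open KleinGroup

instance : CompactSpace KleinBottle := inferInstanceAs (CompactSpace (Quot KleinGlue))

instance : PathConnectedSpace KleinBottle :=
  Quot.mk_surjective.pathConnectedSpace continuous_proj

theorem proj_zero_left (t : I) : proj (0, t) = proj (1, t) := Quot.sound (.sides t)

theorem proj_zero_right (s : I) : proj (s, 0) = proj (unitInterval.symm s, 1) :=
  Quot.sound (.flip s)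

theorem proj_fract_left (s t : I) : proj (⟨Int.fract s, fract_mem s⟩, t) = proj (s, t) := by
  obtain rfl | hs := eq_or_ne s 1
  · simpa using! proj_zero_left t
  · have : Int.fract (s : ℝ) = s :=
      Int.fract_eq_self.mpr ⟨s.2.1, unitInterval.lt_one_iff_ne_one.mpr hs⟩
    simp only [this]

theorem proj_fract_neg_zero (s : I) :
    proj (⟨Int.fract (-s), fract_mem (-s)⟩, 0) = proj (s, 1) := by
  have hfract : Int.fract (-s : ℝ) = Int.fract (unitInterval.symm s : ℝ) := by
    rw [unitInterval.coe_symm_eq, sub_eq_neg_add, Int.fract_add_one]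
  simp only [hfract]
  rw [proj_fract_left, proj_zero_right, unitInterval.symm_symm]

/-- The universal covering of the Klein bottle by the plane. The glide `α ^ ⌊y⌋` moves `(x, y)`
into the strip `ℝ × [0, 1)` and changes the sign of `x` accordingly; a translation then moves the
point into the square. -/
noncomputable def cover (p : ℝ × ℝ) : KleinBottle :=
  proj (⟨Int.fract ((-1) ^ ⌊p.2⌋ * p.1), fract_mem _⟩, ⟨Int.fract p.2, fract_mem _⟩)

theorem cover_coe (p : I × I) : cover (p.1, p.2) = proj p := by
  obtain ⟨s, t⟩ := p
  obtain rfl | ht := eq_or_ne t 1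
  · simpa [cover] using! proj_fract_neg_zero s
  · have hmem : (t : ℝ) ∈ Set.Ico 0 1 := ⟨t.2.1, unitInterval.lt_one_iff_ne_one.mpr ht⟩
    simpa [cover, Int.floor_eq_zero_iff.mpr hmem, Int.fract_eq_self.mpr hmem]
      using! proj_fract_left s t

theorem cover_smul (g : KleinGroup) (p : ℝ × ℝ) : cover (g • p) = cover p := by
  obtain ⟨m, n, rfl⟩ := exists_zpow_mul_zpow_eq g
  have hfloor : ⌊p.2 - n⌋ = ⌊p.2⌋ - n := Int.floor_sub_intCast ..
  have hfract : Int.fract ((-1) ^ (⌊p.2⌋ - n) * ((-1) ^ n * p.1 - m)) =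
      Int.fract ((-1) ^ ⌊p.2⌋ * p.1) := by
    have hsign : (-1 : ℝ) ^ (⌊p.2⌋ - n) * (-1) ^ n = (-1) ^ ⌊p.2⌋ := by
      rw [← zpow_add₀ (by norm_num), sub_add_cancel]
    rw [mul_sub, ← mul_assoc, hsign]
    rcases Int.even_or_odd (⌊p.2⌋ - n) with h | h
    · simp [h.neg_one_zpow]
    · simp [h.neg_one_zpow]
  simp only [cover, zpow_mul_zpow_smul, hfloor, hfract, Int.fract_sub_intCast]

/-- The map from the Klein bottle to the orbit space induced by the inclusion of the square. -/
def toOrbitSpace : KleinBottle → OrbitSpace :=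
  Quot.lift (fun p : I × I ↦ Quotient.mk _ ((p.1 : ℝ), (p.2 : ℝ))) (by
    rintro _ _ (t | s)
    · exact Quotient.sound ⟨beta, by simp [beta_smul]⟩
    · refine Quotient.sound ⟨beta ^ (-1 : ℤ) * alpha ^ (1 : ℤ), ?_⟩
      simp only [zpow_mul_zpow_smul]
      simp)

theorem continuous_toOrbitSpace : Continuous toOrbitSpace :=
  continuous_quot_lift _ (continuous_quotient_mk'.comp (by fun_prop))

theorem toOrbitSpace_cover (p : ℝ × ℝ) : toOrbitSpace (cover p) = Quotient.mk _ p := by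
  refine Quotient.sound ⟨beta ^ ⌊(-1) ^ ⌊p.2⌋ * p.1⌋ * alpha ^ ⌊p.2⌋, ?_⟩
  exact zpow_mul_zpow_smul ..

/-- The identification of the Klein bottle with the orbit space, through which the covering of the
latter is transported to `cover`. -/
noncomputable def homeomorphOrbitSpace : KleinBottle ≃ₜ OrbitSpace :=
  Continuous.homeoOfEquivCompactToT2
    (f :=
      { toFun := toOrbitSpace
        invFun := Quotient.lift cover fun _ p ⟨g, hg⟩ ↦ hg ▸ cover_smul g p
        left_inv := by rintro ⟨p⟩; exact cover_coe p
        right_inv := by rintro ⟨p⟩; exact toOrbitSpace_cover p })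
    continuous_toOrbitSpace

theorem isQuotientCoveringMap_cover : IsQuotientCoveringMap cover KleinGroup :=
  isQuotientCoveringMap_quotientMk_of_properlyDiscontinuousSMul.homeomorph_comp
    homeomorphOrbitSpace.symm

/-- The origin as a point over the base point: the lifts of `α` and `β` are taken to start here. -/
noncomputable def origin : cover ⁻¹' {basePoint} := ⟨(0, 0), cover_coe (0, 0)⟩

/-- The isomorphism from the presented group to the fundamental group at the base point, given by
the action on the universal cover. -/
noncomputable def presentation : KleinGroup ≃* FundamentalGroup KleinBottle basePoint :=
  deckMulEquivFundamentalGroup isQuotientCoveringMap_cover origin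

theorem presentation_alpha : presentation alpha = loopClass loopAlpha :=
  have htarget : alpha⁻¹ • ((0, 0) : ℝ × ℝ) = (0, 1) := by
    rw [inv_smul_eq_iff, alpha_smul]; simp
  deckMulEquivFundamentalGroup_eq_of_lift isQuotientCoveringMap_cover (e := origin)
    (Path.cast ⟨⟨fun t : I ↦ (0, (t : ℝ)), by fun_prop⟩, rfl, rfl⟩ (by simp [origin])
      (by simp [origin, htarget]))
    fun t ↦ by simpa using! cover_coe (0, t)

theorem presentation_beta : presentation beta = loopClass loopBeta :=
  have htarget : beta⁻¹ • ((0, 0) : ℝ × ℝ) = (1, 0) := by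
    rw [inv_smul_eq_iff, beta_smul]; simp
  deckMulEquivFundamentalGroup_eq_of_lift isQuotientCoveringMap_cover (e := origin)
    (Path.cast ⟨⟨fun s : I ↦ ((s : ℝ), 0), by fun_prop⟩, rfl, rfl⟩ (by simp [origin])
      (by simp [origin, htarget]))
    fun s ↦ by simpa using! cover_coe (s, 0)

/-- The boundary of the square, traversed counterclockwise from the corner `(0, 0)`; it projects to
the relator, and the four sides are associated as in `mainTheorem1`. -/
noncomputable def squareBoundary : Path ((0, 0) : I × I) (0, 0) :=
  ((((Path.id).prod (.refl 0)).trans ((Path.refl 1).prod .id)).trans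
    ((Path.id).symm.prod (.refl 1))).trans ((Path.refl 0).prod .id).symm

theorem proj_squareBoundary (t : I) :
    proj (squareBoundary t) =
      (((loopBeta.trans loopAlpha).trans loopBeta).trans loopAlpha.symm) t := by
  have hright (t : I) : proj (1, t) = loopAlpha t := (proj_zero_left t).symm
  have htop (s : I) : proj (unitInterval.symm s, 1) = loopBeta s := (proj_zero_right s).symm
  simp only [squareBoundary, Path.trans_apply, Path.symm_apply]
  split_ifs
  · rfl
  · exact hright _
  · exact htop _
  · rfl

theorem boundary_homotopic_refl :
    (((loopBeta.trans loopAlpha).trans loopBeta).trans loopAlpha.symm).Homotopic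
      (Path.refl basePoint) := by
  have hboundary : squareBoundary.map continuous_proj =
      ((loopBeta.trans loopAlpha).trans loopBeta).trans loopAlpha.symm :=
    Path.ext (funext proj_squareBoundary)
  rw [← hboundary]
  exact (SimplyConnectedSpace.paths_homotopic squareBoundary (.refl _)).map ⟨proj, continuous_proj⟩

end KleinBottle

/-- The first part is the relation as a homotopy of loops, where `trans` concatenates from left to
right. In the second part, the product of Mathlib's `FundamentalGroup` concatenates from right to
left; the reversed word `α⁻¹ β α β` is a cyclic permutation of `β α β α⁻¹`, so both conventions
give the same relation. -/
theorem mainTheorem1 :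
    (((KleinBottle.loopBeta.trans KleinBottle.loopAlpha).trans KleinBottle.loopBeta).trans
        KleinBottle.loopAlpha.symm).Homotopic (Path.refl KleinBottle.basePoint) ∧
    (∃ e : KleinGroup ≃* FundamentalGroup KleinBottle KleinBottle.basePoint,
      e (PresentedGroup.of KleinGen.α) = KleinBottle.loopClass KleinBottle.loopAlpha ∧
      e (PresentedGroup.of KleinGen.β) = KleinBottle.loopClass KleinBottle.loopBeta) ∧
    (∀ x : KleinBottle, Nonempty (KleinGroup ≃* FundamentalGroup KleinBottle x)) :=
  ⟨KleinBottle.boundary_homotopic_refl,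
    ⟨KleinBottle.presentation, KleinBottle.presentation_alpha, KleinBottle.presentation_beta⟩,
    fun x ↦ ⟨KleinBottle.presentation.trans
      (FundamentalGroup.fundamentalGroupMulEquivOfPathConnected KleinBottle.basePoint x)⟩⟩
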